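/- All alphabets are finite, and $\Sigma^*$ denotes the set of words over $\Sigma$. **String streaming settings.** A *string streaming setting* with output set $X$ is a tuple $\mathfrak C=(\mathcal C, I, O, (\!|{-}|\!))$ where $\mathcal C$ is a category, $I$ (the *initial object* of the setting, not assumed to be initial in the categorical sense) and $O$ are arbitrary objects of $\mathcal C$, and $(\!|{-}|\!) : \mathrm{Hom}_{\mathcal C}(I,O)\to X$ is a map of sets. A *$\mathfrak C$-SST* with input alphabet $\Sigma$ is a tuple $(Q,q_0,R,\delta,i,o)$ where $Q$ is a finite set of states, $q_0\in Q$, $R$ is an object of $\mathcal C$, $\delta:\Sigma\times Q\to Q\times\mathrm{Hom}_{\mathcal C}(R,R)$, $i\in \mathrm{Hom}_{\mathcal C}(I,R)$ and $o:Q\to\mathrm{Hom}_{\mathcal C}(R,O)$. It computes the function $\Sigma^*\to X$ that maps $w_1\cdots w_n$ to $(\!|o(q_n)\circ f_n\circ\dots\circ f_1\circ i|\!)$, where $(q_k,f_k)=\delta(w_k,q_{k-1})$ for $1\le k\le n$. **Regular string functions.** For finite sets $R,S$, a *copyless register transition* from $R$ to $S$ over the alphabet $\Gamma$ is a map $t:S\to(\Gamma+R)^*$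 such that each $r\in R$ occurs at most once, in total, in the words $t(s)$, $s\in S$. It acts as the map $t^\dagger:(\Gamma^*)^R\to(\Gamma^*)^S$ that sends $(x_r)_{r\in R}$ to the family whose component at $s$ is $t(s)$ with every $r$ replaced by $x_r$. A *copyless streaming string transducer* from $\Sigma^*$ to $\Gamma^*$ consists of finite sets $Q$ (states) and $R$ (registers), an initial state $q_0\in Q$, a map $\delta$ from $\Sigma\times Q$ to pairs of a state and a copyless register transition from $R$ to $R$, a copyless register transition $i$ from $\varnothing$ to $R$, and for each state $q$ a copyless register transition $o(q)$ from $R$ to a one-element set. It computes the function $w_1\cdots w_n\mapsto o(q_n)^\dagger(t_n^\dagger(\cdots t_1^\dagger(i^\dagger(\varnothing))\cdots))\in\Gamma^*$, where $(q_k,t_k)=\delta(w_k,q_{k-1})$. A function $\Sigma^*\to\Gamma^*$ is *regular* if it is computed by some copyless streaming string transducer. **Quasi-affineness.** A monoidal category $(\mathcal C,\otimes,\mathbf 1)$ is *quasi-affine* if every object $A$ of $\mathcal C$ has a cartesian product with the unit $\mathbf 1$. **Theorem.** 1. Let $\mathfrak C=(\mathcal C,I,O,(\!|{-}|\!))$ be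 a string streaming setting with output set $X$, whose underlying category is equipped with a symmetric monoidal closed structure $(\mathcal C,\otimes,\mathbf 1)$ that is quasi-affine, and suppose that $I=\mathbf 1$. Then, for any $f:\Gamma^*\to X$ computed by some $\mathfrak C$-SST and any regular function $g:\Sigma^*\to\Gamma^*$, the function $f\circ g:\Sigma^*\to X$ is computed by some $\mathfrak C$-SST. In other words, the class of functions computed by $\mathfrak C$-SSTs is closed under precomposition by regular string functions. 2. If $L\subseteq\Gamma^*$ is a regular language and $g:\Sigma^*\to\Gamma^*$ is a regular function, then $g^{-1}(L)\subseteq\Sigma^*$ is a regular language. 3. If $f:\Gamma^*\to\Delta^*$ and $g:\Sigma^*\to\Gamma^*$ are regular functions, then $f\circ g:\Sigma^*\to\Delta^*$ is a regular function. -/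

import Mathlib

open CategoryTheory MonoidalCategory

/-! ### Register transitions, copyless streaming string transducers, regular string functions -/

/-- A `Γ`-register transition `t : S → (Γ + R)*` from `R` to `S` is copyless when every register
`r ∈ R` occurs at most once, in total, in the words `t s` for `s ∈ S`. -/
def RegisterCopyless {Γ R S : Type*} [Fintype S] (t : S → List (Γ ⊕ R)) : Prop :=
  open Classical in ∀ r : R, ∑ s : S, (t s).countP (fun x => x = Sum.inr r) ≤ 1

/-- The set of copyless `Γ`-register transitions from `R` to `S`. -/
def RegisterTransition (Γ R S : Type*) [Fintype S] :=
  {t : S → List (Γ ⊕ R) // RegisterCopyless t}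

/-- The action `t† : (Γ*)^R → (Γ*)^S` of a register transition from `R` to `S`: each register
variable `r` is replaced by the string `x r`. -/
def RegisterTransition.act {Γ R S : Type*} [Fintype S] (t : RegisterTransition Γ R S)
    (x : R → List Γ) : S → List Γ :=
  fun s => (t.1 s).flatMap (Sum.elim (fun c => [c]) x)

/-- A (deterministic) copyless streaming string transducer with input alphabet `α` and output
alphabet `Γ`. -/
structure CopylessSST (α Γ : Type*) where
  /-- states -/
  Q : Type
  [finQ : Finite Q]
  /-- initial state -/
  q₀ : Q
  /-- registers -/
  R : Type
  [finR : Fintype R]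
  /-- transition function -/
  δ : α → Q → Q × RegisterTransition Γ R R
  /-- initial register values -/
  i : RegisterTransition Γ Empty R
  /-- output recombination, depending on the final state -/
  o : Q → RegisterTransition Γ R Unit

attribute [instance] CopylessSST.finQ CopylessSST.finR

namespace CopylessSST

variable {α Γ : Type*} (T : CopylessSST α Γ)

/-- One step: read a letter, update the current state and the register values. -/
def step (c : T.Q × (T.R → List Γ)) (a : α) : T.Q × (T.R → List Γ) :=
  ((T.δ a c.1).1, (T.δ a c.1).2.act c.2)

/-- The configuration reached after reading a word from left to right. -/
def config (w : List α) : T.Q × (T.R → List Γ) :=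
  w.foldl T.step (T.q₀, T.i.act Empty.elim)

/-- The function `α* → Γ*` computed by a copyless streaming string transducer. -/
def eval (w : List α) : List Γ :=
  (T.o (T.config w).1).act (T.config w).2 ()

end CopylessSST

/-- A string function is regular when it is computed by some copyless streaming string
transducer. -/
def IsRegularFunction {α Γ : Type*} (g : List α → List Γ) : Prop :=
  ∃ T : CopylessSST α Γ, T.eval = g

/-! ### String streaming settings and their transducers -/

/-- A string streaming setting with output set `X` and underlying category `C`. -/
structure StreamingSetting (C : Type*) [Category C] (X : Type*) where
  /-- the initial object of memory (not assumed to be initial in the categorical sense) -/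
  start : C
  /-- the output object -/
  final : C
  /-- the interpretation of morphisms from `start` to `final` as outputs -/
  interp : (start ⟶ final) → X

/-- An SST over the streaming setting `𝔖`, with input alphabet `α`. -/
structure SettingSST {C : Type*} [Category C] {X : Type*} (𝔖 : StreamingSetting C X)
    (α : Type*) where
  /-- states -/
  Q : Type
  [finQ : Finite Q]
  /-- initial state -/
  q₀ : Q
  /-- memory object -/
  R : C
  /-- transition function -/
  δ : α → Q → Q × (R ⟶ R)
  /-- initialization morphism -/
  i : 𝔖.start ⟶ R
  /-- output morphisms -/
  o : Q → (R ⟶ 𝔖.final)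

attribute [instance] SettingSST.finQ

namespace SettingSST

variable {C : Type*} [Category C] {X : Type*} {𝔖 : StreamingSetting C X} {α : Type*}
  (T : SettingSST 𝔖 α)

/-- One step: read a letter, update the state, post-compose with the transition morphism. -/
def step (c : T.Q × (𝔖.start ⟶ T.R)) (a : α) : T.Q × (𝔖.start ⟶ T.R) :=
  ((T.δ a c.1).1, c.2 ≫ (T.δ a c.1).2)

/-- After reading `w` of length `n`: the state `qₙ` and the morphism `fₙ ∘ ⋯ ∘ f₁ ∘ i`. -/
def config (w : List α) : T.Q × (𝔖.start ⟶ T.R) :=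
  w.foldl T.step (T.q₀, T.i)

/-- The function `α* → X` computed by an SST over a streaming setting. -/
def eval (w : List α) : X :=
  𝔖.interp ((T.config w).2 ≫ T.o (T.config w).1)

end SettingSST

/-- `f : α* → X` is computed by some (stateful) SST over the streaming setting `𝔖`. -/
def StreamingSetting.Computes {C : Type*} [Category C] {X : Type*} (𝔖 : StreamingSetting C X)
    {α : Type*} (f : List α → X) : Prop :=
  ∃ T : SettingSST 𝔖 α, T.eval = f

/-- A monoidal category is quasi-affine when every object has a cartesian product with the
monoidal unit. -/
def QuasiAffine (C : Type*) [Category C] [MonoidalCategory C] : Prop :=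
  ∀ A : C, Limits.HasBinaryProduct A (𝟙_ C)

/-!
The proof works in a *memory model*: a category reduced to the action of its morphisms on global
points, with a symmetric tensor product. Two models matter, that of a symmetric monoidal closed
quasi-affine category and that of copyless register transitions. In both, the maps induced by
endomorphisms of an object `M` are *internalized*: they have names which are points of another
object, and names can be composed, evaluated and erased by morphisms, possibly depending on a finite
amount of information about them, their shape (`MemoryModel.internalOfClosed`,
`MemoryModel.internalOfRegisters`). Quasi-affineness provides the erasure, by replacing `M ⊸ M` by
`(M ⊸ M) × 𝟙`. Register transitions form no closed category, but the shape of a transition `R → R`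
ranges over a finite set, and the segments of letters between its variables fit into registers.

Let `f` be computed by a machine over such a model, with states `Q`, and let `g` be computed by a
copyless transducer with registers `R`. The content of a register of `g` acts on a configuration of
the machine for `f` through a map `Q → Q` and, for each `q : Q`, an update of its memory. The maps
`Q → Q` are finite information. The updates cannot all be stored, because the update of one new
register may use the same old update several times, for various states. But once the states from
which the new registers will be read are fixed, copylessness ensures that each old register is read
from one state only. So `f ∘ g` is computed by a machine with a *family* of memories, indexed by
`h : R → Q`, the component `h` holding for each `r` a name of the effect of `r` from the state `h r`
(`MemoryModel.Machine.exists_comp`). Here several components may depend on the same old one: the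
family is a formal cartesian product, of which a single component is used in the end.

Such families are then eliminated by induction on their number of components
(`MemoryModel.FamilyMachine.exists_pred`). A family with `n + 1` components is represented by one
with `n` components, together with names of maps that lead from it to the actual contents. While the
transitions permute the components, composing these names with the current updates is linear. A
transition that is not a permutation depends on at most `n` old components: these become the new
family with `n` components, and the names start afresh. This uses a tensor product with one factor
per component, and no copy.

For regular languages, an automaton directly tracks the effect of each register on the states of the
given automaton.
-/

/-! ### Words with variables -/

/-- The variables occurring in a word. -/
def wordVars {A J : Type*} (W : List (A ⊕ J)) : List J := W.filterMap Sum.getRight?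

@[simp] theorem wordVars_nil {A J : Type*} : wordVars ([] : List (A ⊕ J)) = [] := rfl

@[simp] theorem wordVars_inl {A J : Type*} (a : A) (W : List (A ⊕ J)) :
    wordVars (Sum.inl a :: W) = wordVars W := rfl

@[simp] theorem wordVars_inr {A J : Type*} (j : J) (W : List (A ⊕ J)) :
    wordVars (Sum.inr j :: W) = j :: wordVars W := rfl

/-! ### Memory models -/

set_option linter.checkUnivs false in
/-- The part of a symmetric monoidal category that acts on global points: objects, morphisms, the
points `Pt M` of each object, the action of morphisms on points, and a tensor product whose
structural morphisms are only required to do the expected thing on pairs of points. No categorical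
law is required beyond compatibility with the action. -/
structure MemoryModel.{u, v} where
  /-- memory objects -/
  Obj : Type u
  /-- memory updates -/
  Hom : Obj → Obj → Type v
  /-- memory contents, to be thought of as morphisms from the unit -/
  Pt : Obj → Type v
  /-- the effect of an update on a content -/
  act {M N : Obj} : Hom M N → Pt M → Pt N
  /-- identity -/
  id (M : Obj) : Hom M M
  act_id {M : Obj} (x : Pt M) : act (id M) x = x
  /-- composition, in diagrammatic order -/
  comp {M N P : Obj} : Hom M N → Hom N P → Hom M P
  act_comp {M N P : Obj} (f : Hom M N) (g : Hom N P) (x : Pt M) : act (comp f g) x = act g (act f x)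
  /-- tensor unit -/
  unit : Obj
  /-- the canonical point of the unit -/
  star : Pt unit
  /-- constant updates -/
  const {M : Obj} : Pt M → Hom unit M
  act_const {M : Obj} (x : Pt M) : act (const x) star = x
  /-- tensor product -/
  tensor : Obj → Obj → Obj
  /-- tensor product of points -/
  pair {M N : Obj} : Pt M → Pt N → Pt (tensor M N)
  /-- functoriality of the tensor product -/
  map {M M' N N' : Obj} : Hom M M' → Hom N N' → Hom (tensor M N) (tensor M' N')
  act_map {M M' N N' : Obj} (f : Hom M M') (g : Hom N N') (x : Pt M) (y : Pt N) :
    act (map f g) (pair x y) = pair (act f x) (act g y)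
  /-- symmetry -/
  swap (M N : Obj) : Hom (tensor M N) (tensor N M)
  act_swap {M N : Obj} (x : Pt M) (y : Pt N) : act (swap M N) (pair x y) = pair y x
  /-- associator -/
  assoc (M N P : Obj) : Hom (tensor (tensor M N) P) (tensor M (tensor N P))
  act_assoc {M N P : Obj} (x : Pt M) (y : Pt N) (z : Pt P) :
    act (assoc M N P) (pair (pair x y) z) = pair x (pair y z)
  /-- inverse associator -/
  assocInv (M N P : Obj) : Hom (tensor M (tensor N P)) (tensor (tensor M N) P)
  act_assocInv {M N P : Obj} (x : Pt M) (y : Pt N) (z : Pt P) :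
    act (assocInv M N P) (pair x (pair y z)) = pair (pair x y) z
  /-- left unitor -/
  unitor (M : Obj) : Hom (tensor unit M) M
  act_unitor {M : Obj} (x : Pt M) : act (unitor M) (pair star x) = x
  /-- inverse left unitor -/
  unitorInv (M : Obj) : Hom M (tensor unit M)
  act_unitorInv {M : Obj} (x : Pt M) : act (unitorInv M) x = pair star x

namespace MemoryModel

attribute [simp] act_id act_comp act_const act_map act_swap act_assoc act_assocInv act_unitor
  act_unitorInv

/-- An internalization of the endomorphisms of `M`: an object `B` whose points name maps
`Pt M → Pt M`, up to a finite amount of information, the *shape*. `Rep k b φ` says that the point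
`b` with shape `k` names `φ`. Names can be composed, evaluated and discarded by updates that depend
only on the shapes involved. For an internal hom, affine or made so by a product with the unit,
there is a single shape; register transitions need several. -/
structure Internal (𝒜 : MemoryModel) (M : 𝒜.Obj) where
  /-- shapes -/
  K : Type
  [finK : Finite K]
  /-- the object of names -/
  B : 𝒜.Obj
  /-- the naming relation -/
  Rep : K → 𝒜.Pt B → (𝒜.Pt M → 𝒜.Pt M) → Prop
  /-- the shape of an update -/
  shape : 𝒜.Hom M M → K
  /-- the name of an update -/
  name : 𝒜.Hom M M → 𝒜.Pt B
  rep_name (f : 𝒜.Hom M M) : Rep (shape f) (name f) (𝒜.act f)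
  /-- the shape of a composite -/
  mul : K → K → K
  /-- composition of names, in diagrammatic order -/
  comp : K → K → 𝒜.Hom (𝒜.tensor B B) B
  rep_comp {k l : K} {b c : 𝒜.Pt B} {φ ψ : 𝒜.Pt M → 𝒜.Pt M} : Rep k b φ → Rep l c ψ →
    Rep (mul k l) (𝒜.act (comp k l) (𝒜.pair b c)) (ψ ∘ φ)
  /-- application of a name to a content -/
  ev : K → 𝒜.Hom (𝒜.tensor M B) M
  act_ev {k : K} {b : 𝒜.Pt B} {φ : 𝒜.Pt M → 𝒜.Pt M} (x : 𝒜.Pt M) : Rep k b φ →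
    𝒜.act (ev k) (𝒜.pair x b) = φ x
  /-- erasure of names -/
  disc : 𝒜.Hom B 𝒜.unit
  act_disc {k : K} {b : 𝒜.Pt B} {φ : 𝒜.Pt M → 𝒜.Pt M} : Rep k b φ → 𝒜.act disc b = 𝒜.star

attribute [instance] Internal.finK

/-! ### Tensor powers indexed by lists -/

variable {𝒜 : MemoryModel} {ι J σ : Type*}

/-- The tensor power of `B` with one factor per entry of a list. -/
@[reducible] def pow (B : 𝒜.Obj) : List ι → 𝒜.Obj
  | [] => 𝒜.unit
  | _ :: l => 𝒜.tensor B (pow B l)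

/-- The point of a tensor power whose factor at the entry `i` is `b i`. -/
def tup {B : 𝒜.Obj} (b : ι → 𝒜.Pt B) : (l : List ι) → 𝒜.Pt (pow B l)
  | [] => 𝒜.star
  | i :: l => 𝒜.pair (b i) (tup b l)

theorem exists_split (B : 𝒜.Obj) (l₁ l₂ : List ι) :
    ∃ F : 𝒜.Hom (pow B (l₁ ++ l₂)) (𝒜.tensor (pow B l₁) (pow B l₂)),
      ∀ b : ι → 𝒜.Pt B, 𝒜.act F (tup b (l₁ ++ l₂)) = 𝒜.pair (tup b l₁) (tup b l₂) := by
  induction l₁ with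
  | nil => exact ⟨𝒜.unitorInv _, fun b => 𝒜.act_unitorInv _⟩
  | cons i l ih =>
    obtain ⟨F, hF⟩ := ih
    refine ⟨𝒜.comp (𝒜.map (𝒜.id B) F) (𝒜.assocInv _ _ _), fun b => ?_⟩
    simp only [List.cons_append, tup]
    simp [hF]

theorem exists_perm (B : 𝒜.Obj) {l₁ l₂ : List ι} (h : l₁.Perm l₂) :
    ∃ F : 𝒜.Hom (pow B l₁) (pow B l₂), ∀ b : ι → 𝒜.Pt B, 𝒜.act F (tup b l₁) = tup b l₂ := by
  induction h with
  | nil => exact ⟨𝒜.id _, fun b => 𝒜.act_id _⟩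
  | cons i _ ih =>
    obtain ⟨F, hF⟩ := ih
    exact ⟨𝒜.map (𝒜.id B) F, fun b => by simp [tup, hF]⟩
  | swap i j l =>
    exact ⟨𝒜.comp (𝒜.comp (𝒜.assocInv B B (pow B l)) (𝒜.map (𝒜.swap B B) (𝒜.id _)))
      (𝒜.assoc B B (pow B l)), fun b => by simp [tup]⟩
  | trans _ _ ih₁ ih₂ =>
    obtain ⟨F, hF⟩ := ih₁
    obtain ⟨G, hG⟩ := ih₂
    exact ⟨𝒜.comp F G, fun b => by simp [hF, hG]⟩

theorem exists_map (B : 𝒜.Obj) (g : J → ι) (l : List J) :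
    ∃ F : 𝒜.Hom (pow B (l.map g)) (pow B l),
      ∀ b : ι → 𝒜.Pt B, 𝒜.act F (tup b (l.map g)) = tup (b ∘ g) l := by
  induction l with
  | nil => exact ⟨𝒜.id _, fun b => 𝒜.act_id _⟩
  | cons i l ih =>
    obtain ⟨F, hF⟩ := ih
    refine ⟨𝒜.map (𝒜.id B) F, fun b => ?_⟩
    change 𝒜.act (𝒜.map (𝒜.id B) F) (𝒜.pair (b (g i)) (tup b (l.map g))) =
      𝒜.pair (b (g i)) (tup (b ∘ g) l)
    simp [hF]

namespace Internal

variable {M : 𝒜.Obj} (N : 𝒜.Internal M)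

/-- A point of `N.B` is a name when it names some map with some shape. -/
def IsName (b : 𝒜.Pt N.B) : Prop := ∃ k φ, N.Rep k b φ

theorem exists_sublist {l₁ l₂ : List ι} (h : l₁.Sublist l₂) :
    ∃ F : 𝒜.Hom (pow N.B l₂) (pow N.B l₁), ∀ b : ι → 𝒜.Pt N.B, (∀ i, N.IsName (b i)) →
      𝒜.act F (tup b l₂) = tup b l₁ := by
  induction h with
  | slnil => exact ⟨𝒜.id _, fun b _ => 𝒜.act_id _⟩
  | cons i _ ih =>
    obtain ⟨F, hF⟩ := ih
    refine ⟨𝒜.comp (𝒜.map N.disc F) (𝒜.unitor _), fun b hb => ?_⟩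
    obtain ⟨k, φ, hi⟩ := hb i
    simp [tup, hF b hb, N.act_disc hi]
  | cons_cons i _ ih =>
    obtain ⟨F, hF⟩ := ih
    exact ⟨𝒜.map (𝒜.id _) F, fun b hb => by simp [tup, hF b hb]⟩

/-- Names can be permuted and erased, but not duplicated. -/
theorem exists_subperm {l₁ l₂ : List ι} (h : l₁.Subperm l₂) :
    ∃ F : 𝒜.Hom (pow N.B l₂) (pow N.B l₁), ∀ b : ι → 𝒜.Pt N.B, (∀ i, N.IsName (b i)) →
      𝒜.act F (tup b l₂) = tup b l₁ := by
  obtain ⟨l, hl, hs⟩ := h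
  obtain ⟨F, hF⟩ := N.exists_sublist hs
  obtain ⟨G, hG⟩ := exists_perm N.B hl
  exact ⟨𝒜.comp F G, fun b hb => by simp [hF b hb, hG]⟩

/-! ### Words of updates and named maps -/

/-- The map denoted by a word of updates and of variables, applied from left to right. -/
def denote (φ : J → 𝒜.Pt M → 𝒜.Pt M) (W : List (𝒜.Hom M M ⊕ J)) (x : 𝒜.Pt M) : 𝒜.Pt M :=
  W.foldl (fun x e => Sum.elim (fun f => 𝒜.act f x) (fun j => φ j x) e) x

/-- The shape of the map denoted by a word, given shapes for the variables. -/
def wordShape (κ : J → N.K) : List (𝒜.Hom M M ⊕ J) → N.K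
  | [] => N.shape (𝒜.id M)
  | e :: W => N.mul (Sum.elim N.shape κ e) (wordShape κ W)

theorem exists_word (κ : J → N.K) (W : List (𝒜.Hom M M ⊕ J)) :
    ∃ F : 𝒜.Hom (pow N.B (wordVars W)) N.B, ∀ (b : J → 𝒜.Pt N.B) (φ : J → 𝒜.Pt M → 𝒜.Pt M),
      (∀ j ∈ wordVars W, N.Rep (κ j) (b j) (φ j)) →
        N.Rep (N.wordShape κ W) (𝒜.act F (tup b (wordVars W))) (denote φ W) := by
  induction W with
  | nil =>
    refine ⟨𝒜.const (N.name (𝒜.id M)), fun b φ _ => ?_⟩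
    have h := N.rep_name (𝒜.id M)
    rw [show 𝒜.act (𝒜.id M) = denote φ [] from funext fun x => 𝒜.act_id x] at h
    simpa [wordShape, tup] using h
  | cons e W ih =>
    obtain ⟨F, hF⟩ := ih
    cases e with
    | inl f =>
      rw [wordVars_inl]
      refine ⟨𝒜.comp (𝒜.comp (𝒜.unitorInv _) (𝒜.map (𝒜.const (N.name f)) F))
        (N.comp (N.shape f) (N.wordShape κ W)), fun b φ h => ?_⟩
      change N.Rep (N.mul _ _) _ (denote φ W ∘ 𝒜.act f)
      simpa using N.rep_comp (N.rep_name f) (hF b φ h)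
    | inr j =>
      rw [wordVars_inr]
      refine ⟨𝒜.comp (𝒜.map (𝒜.id _) F) (N.comp (κ j) (N.wordShape κ W)), fun b φ h => ?_⟩
      have := N.rep_comp (h j (by simp)) (hF b φ fun i hi => h i (by simp [hi]))
      change N.Rep (N.mul _ _) _ (denote φ W ∘ φ j)
      simpa [tup] using this

theorem exists_words_aux (κ : J → N.K) (W : σ → List (𝒜.Hom M M ⊕ J)) (ls : List σ) :
    ∃ F : 𝒜.Hom (pow N.B (ls.flatMap fun s => wordVars (W s))) (pow N.B ls),
      ∀ (b : J → 𝒜.Pt N.B) (φ : J → 𝒜.Pt M → 𝒜.Pt M),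
      (∀ s ∈ ls, ∀ j ∈ wordVars (W s), N.Rep (κ j) (b j) (φ j)) →
        ∃ b' : σ → 𝒜.Pt N.B, 𝒜.act F (tup b (ls.flatMap fun s => wordVars (W s))) = tup b' ls ∧
          ∀ s ∈ ls, N.Rep (N.wordShape κ (W s)) (b' s) (denote φ (W s)) := by
  choose F hF using fun s => N.exists_word κ (W s)
  suffices ∃ G : 𝒜.Hom (pow N.B (ls.flatMap fun s => wordVars (W s))) (pow N.B ls),
      ∀ b : J → 𝒜.Pt N.B, 𝒜.act G (tup b (ls.flatMap fun s => wordVars (W s)))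
        = tup (fun s => 𝒜.act (F s) (tup b (wordVars (W s)))) ls by
    obtain ⟨G, hG⟩ := this
    exact ⟨G, fun b φ h => ⟨_, hG b, fun s hs => hF s b φ (h s hs)⟩⟩
  clear hF
  induction ls with
  | nil => exact ⟨𝒜.id _, fun b => 𝒜.act_id _⟩
  | cons s ls ih =>
    obtain ⟨G, hG⟩ := ih
    obtain ⟨D, hD⟩ := exists_split N.B (wordVars (W s)) (ls.flatMap fun s => wordVars (W s))
    refine ⟨𝒜.comp D (𝒜.map (F s) G), fun b => ?_⟩
    change 𝒜.act (𝒜.comp D (𝒜.map (F s) G)) (tup b (wordVars (W s) ++ ls.flatMap fun s => wordVars (W s))) =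
      𝒜.pair (𝒜.act (F s) (tup b (wordVars (W s)))) (tup _ ls)
    simp [hD, hG]

/-- Linear substitution: a family of words in which every variable is used at most once in total
(the variable `j` being read from the slot `reg j`) acts on tuples of names by a single update. -/
theorem exists_words (κ : J → N.K) (reg : J → ι) (W : σ → List (𝒜.Hom M M ⊕ J)) (l : List ι)
    (ls : List σ) (hsub : ((ls.flatMap fun s => wordVars (W s)).map reg).Subperm l) :
    ∃ F : 𝒜.Hom (pow N.B l) (pow N.B ls),
      ∀ (b : ι → 𝒜.Pt N.B) (φ : J → 𝒜.Pt M → 𝒜.Pt M), (∀ i, N.IsName (b i)) →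
      (∀ s ∈ ls, ∀ j ∈ wordVars (W s), N.Rep (κ j) (b (reg j)) (φ j)) →
        ∃ b' : σ → 𝒜.Pt N.B, 𝒜.act F (tup b l) = tup b' ls ∧
          ∀ s ∈ ls, N.Rep (N.wordShape κ (W s)) (b' s) (denote φ (W s)) := by
  obtain ⟨F, hF⟩ := N.exists_subperm hsub
  obtain ⟨G, hG⟩ := exists_map N.B reg (ls.flatMap fun s => wordVars (W s))
  obtain ⟨D, hD⟩ := N.exists_words_aux κ W ls
  refine ⟨𝒜.comp (𝒜.comp F G) D, fun b φ hb h => ?_⟩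
  obtain ⟨b', h₁, h₂⟩ := hD (b ∘ reg) φ h
  exact ⟨b', by simpa [hF b hb, hG] using h₁, h₂⟩

/-- Evaluation at a single slot of a tuple of names, the other slots being erased. -/
theorem exists_evalAt (κ : ι → N.K) {l : List ι} {i : ι} (hi : i ∈ l) :
    ∃ F : 𝒜.Hom (𝒜.tensor M (pow N.B l)) M, ∀ (x : 𝒜.Pt M) (b : ι → 𝒜.Pt N.B)
      (φ : ι → 𝒜.Pt M → 𝒜.Pt M), (∀ i, N.Rep (κ i) (b i) (φ i)) →
        𝒜.act F (𝒜.pair x (tup b l)) = φ i x := by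
  obtain ⟨F, hF⟩ := N.exists_sublist (List.singleton_sublist.2 hi)
  let U : 𝒜.Hom (𝒜.tensor N.B 𝒜.unit) N.B := 𝒜.comp (𝒜.swap _ _) (𝒜.unitor _)
  refine ⟨𝒜.comp (𝒜.map (𝒜.id M) (𝒜.comp F U)) (N.ev (κ i)), fun x b φ h => ?_⟩
  have hU : 𝒜.act U (tup b [i]) = b i := by simp [U, tup]
  simp [hF b fun i => ⟨_, _, h i⟩, hU, N.act_ev x (h i)]

end Internal

end MemoryModel

namespace MemoryModel

/-! ### Machines, and machines with an additive family of memories -/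

/-- A deterministic finite-state machine whose memory lives in the model `𝒜`. -/
structure Machine (𝒜 : MemoryModel) (O : 𝒜.Obj) (α : Type*) where
  /-- states -/
  Q : Type
  [finQ : Finite Q]
  /-- initial state -/
  q₀ : Q
  /-- memory object -/
  M : 𝒜.Obj
  /-- initial content -/
  i : 𝒜.Pt M
  /-- transition function -/
  δ : α → Q → Q × 𝒜.Hom M M
  /-- output -/
  o : Q → 𝒜.Hom M O

attribute [instance] Machine.finQ

variable {𝒜 : MemoryModel} {O : 𝒜.Obj} {α : Type*}

namespace Machine

variable (T : 𝒜.Machine O α)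

/-- One step of a machine. -/
def step (c : T.Q × 𝒜.Pt T.M) (a : α) : T.Q × 𝒜.Pt T.M :=
  ((T.δ a c.1).1, 𝒜.act (T.δ a c.1).2 c.2)

/-- The output of a configuration. -/
def out (c : T.Q × 𝒜.Pt T.M) : 𝒜.Pt O := 𝒜.act (T.o c.1) c.2

/-- The function computed by a machine. -/
def eval (w : List α) : 𝒜.Pt O := T.out (w.foldl T.step (T.q₀, T.i))

end Machine

/-- A machine that maintains a family of contents of the same memory object `M`, indexed by a
finite type `H`. Each new component is computed from a single old one, but distinct components may
use the same old one: the memory is the formal additive (cartesian) product of `H` copies of `M`.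
The initial family consists of updates of a single content. -/
structure FamilyMachine (𝒜 : MemoryModel) (O : 𝒜.Obj) (α H : Type*) where
  /-- states -/
  Q : Type
  [finQ : Finite Q]
  /-- initial state -/
  q₀ : Q
  /-- memory object -/
  M : 𝒜.Obj
  /-- seed of the initial family -/
  i : 𝒜.Pt M
  /-- the initial family, as updates of the seed -/
  j : H → 𝒜.Hom M M
  /-- transition function -/
  δ : α → Q → Q × (H → H × 𝒜.Hom M M)
  /-- output, using a single component -/
  o : Q → H × 𝒜.Hom M O

attribute [instance] FamilyMachine.finQ

namespace FamilyMachine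

variable {H : Type*} (T : 𝒜.FamilyMachine O α H)

/-- The initial configuration. -/
def init : T.Q × (H → 𝒜.Pt T.M) := (T.q₀, fun h => 𝒜.act (T.j h) T.i)

/-- The family of contents obtained by applying a transition to a family of contents. -/
def transform {M : 𝒜.Obj} {H : Type*} (τ : H → H × 𝒜.Hom M M) (V : H → 𝒜.Pt M) (h : H) : 𝒜.Pt M :=
  𝒜.act (τ h).2 (V (τ h).1)

/-- One step of a family machine. -/
def step (c : T.Q × (H → 𝒜.Pt T.M)) (a : α) : T.Q × (H → 𝒜.Pt T.M) :=
  ((T.δ a c.1).1, transform (T.δ a c.1).2 c.2)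

/-- The output of a configuration. -/
def out (c : T.Q × (H → 𝒜.Pt T.M)) : 𝒜.Pt O := 𝒜.act (T.o c.1).2 (c.2 (T.o c.1).1)

/-- The function computed by a family machine. -/
def eval (w : List α) : 𝒜.Pt O := T.out (w.foldl T.step T.init)

end FamilyMachine

open FamilyMachine in
/-- A deterministic transition system is implemented by a family machine as soon as it is simulated
by families of contents together with a finite amount of information, which must determine the
updates to be performed. -/
theorem exists_familyMachine_of_simulation {H Cfg : Type*} (init : Cfg) (step : Cfg → α → Cfg)
    (out : Cfg → 𝒜.Pt O) {Z : Type} [Finite Z] (M : 𝒜.Obj) (Rel : Cfg → Z → (H → 𝒜.Pt M) → Prop)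
    (hinit : ∃ z i, ∃ j : H → 𝒜.Hom M M, Rel init z fun h => 𝒜.act (j h) i)
    (hstep : ∀ a z, ∃ z' τ, ∀ c V, Rel c z V → Rel (step c a) z' (transform τ V))
    (hout : ∀ z, ∃ h, ∃ g : 𝒜.Hom M O, ∀ c V, Rel c z V → 𝒜.act g (V h) = out c) :
    ∃ T : 𝒜.FamilyMachine O α H, T.eval = fun w => out (w.foldl step init) := by
  obtain ⟨z₀, i, j, h₀⟩ := hinit
  choose z' τ hstep using hstep
  choose h g hout using hout
  refine ⟨{ Q := Z, q₀ := z₀, M := M, i := i, j := j, δ := fun a z => (z' a z, τ a z),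
            o := fun z => (h z, g z) }, funext fun w => ?_⟩
  apply hout
  induction w using List.reverseRecOn with
  | nil => exact h₀
  | append_singleton w a ih =>
    simp only [List.foldl_append, List.foldl_cons, List.foldl_nil]
    exact hstep a _ _ _ ih

/-- The index type of a family machine can be replaced by an equivalent one. -/
theorem FamilyMachine.exists_equiv {H H' : Type*} (e : H ≃ H') (T : 𝒜.FamilyMachine O α H) :
    ∃ T' : 𝒜.FamilyMachine O α H', T'.eval = T.eval := by
  refine exists_familyMachine_of_simulation T.init T.step T.out T.M
    (fun c z V => c.1 = z ∧ c.2 = V ∘ e)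
    ⟨T.q₀, T.i, T.j ∘ e.symm, rfl, by funext h; simp [init]⟩
    (fun a z => ⟨(T.δ a z).1,
      fun h => (e ((T.δ a z).2 (e.symm h)).1, ((T.δ a z).2 (e.symm h)).2), ?_⟩)
    (fun z => ⟨e (T.o z).1, (T.o z).2, ?_⟩)
  · rintro ⟨q, U⟩ V ⟨rfl, hU⟩
    refine ⟨rfl, funext fun h => ?_⟩
    simp only at hU
    simp [step, transform, hU]
  · rintro ⟨q, U⟩ V ⟨rfl, hU⟩
    simp only at hU
    simp [out, hU]

/-! ### Elimination of families -/

open Internal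

/-- A tuple of names of the maps `E h`, with shapes `κ h`. -/
def IsTuple {M : 𝒜.Obj} (N : 𝒜.Internal M) {ι : Type*} (l : List ι) (κ : ι → N.K)
    (E : ι → 𝒜.Pt M → 𝒜.Pt M) (p : 𝒜.Pt (pow N.B l)) : Prop :=
  ∃ b : ι → 𝒜.Pt N.B, p = tup b l ∧ ∀ i, N.Rep (κ i) (b i) (E i)

/-- A tuple of names can be composed with a bijective family of updates. -/
theorem Internal.exists_tuple_step {M : 𝒜.Obj} (N : 𝒜.Internal M) {n : ℕ}
    (κ : Fin n → N.K) {ρ : Fin n → Fin n} (hρ : Function.Injective ρ) (m : Fin n → 𝒜.Hom M M) :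
    ∃ (κ' : Fin n → N.K) (F : 𝒜.Hom (pow N.B (List.finRange n)) (pow N.B (List.finRange n))),
      ∀ E p, IsTuple N (List.finRange n) κ E p →
        IsTuple N (List.finRange n) κ' (fun h => 𝒜.act (m h) ∘ E (ρ h)) (𝒜.act F p) := by
  obtain ⟨F, hF⟩ := N.exists_words κ (fun h => h) (fun h => [Sum.inr (ρ h), Sum.inl (m h)])
    (List.finRange n) (List.finRange n) (by
      refine List.Nodup.subperm ?_ (fun _ _ => List.mem_finRange _)
      simpa [← List.map_eq_flatMap, Function.comp_def] using (List.nodup_finRange n).map hρ)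
  refine ⟨fun h => N.wordShape κ [Sum.inr (ρ h), Sum.inl (m h)], F, ?_⟩
  rintro E p ⟨b, rfl, hb⟩
  obtain ⟨b', h₁, h₂⟩ := hF b E (fun i => ⟨_, _, hb i⟩) (fun _ _ j _ => hb j)
  exact ⟨b', h₁, fun h => h₂ h (List.mem_finRange h)⟩

/-- A tuple of names of given updates can be created from nothing. -/
theorem Internal.exists_tuple_const {M : 𝒜.Obj} (N : 𝒜.Internal M) {n : ℕ}
    (m : Fin n → 𝒜.Hom M M) : ∃ p, IsTuple N (List.finRange n) (fun h => N.shape (m h))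
      (fun h => 𝒜.act (m h)) p :=
  ⟨_, fun h => N.name (m h), rfl, fun h => N.rep_name (m h)⟩

/-- A family indexed by `n + 2` elements can be traded for one indexed by `n + 1` elements. The new
memory consists of a family `P` with `n + 1` components, and of names of maps `E h` leading from
`P (σ h)` to the component `h` of the simulated family. As long as the transitions permute the
components, only `E` is updated. When a component is lost, the surviving ones fit into `P`. -/
theorem FamilyMachine.exists_pred (N : ∀ M, 𝒜.Internal M) {n : ℕ}
    (T : 𝒜.FamilyMachine O α (Fin (n + 2))) :
    ∃ T' : 𝒜.FamilyMachine O α (Fin (n + 1)), T'.eval = T.eval := by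
  let I := N T.M
  refine exists_familyMachine_of_simulation T.init T.step T.out
    (Z := T.Q × (Fin (n + 2) → Fin (n + 1)) × (Fin (n + 2) → I.K))
    (𝒜.tensor T.M (pow I.B (List.finRange (n + 2))))
    (fun c z V => c.1 = z.1 ∧ ∃ (P : Fin (n + 1) → 𝒜.Pt T.M) (E : _) (p : _),
      IsTuple I (List.finRange (n + 2)) z.2.2 E p ∧
      (∀ s, V s = 𝒜.pair (P s) p) ∧ ∀ h, c.2 h = E h (P (z.2.1 h))) ?_ ?_ ?_
  · obtain ⟨p, hp⟩ := I.exists_tuple_const T.j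
    exact ⟨(T.q₀, fun _ => 0, _), 𝒜.pair T.i p, fun _ => 𝒜.id _, rfl, fun _ => T.i, _, p, hp,
      fun s => 𝒜.act_id _, fun h => rfl⟩
  · rintro a ⟨q, σ, κ⟩
    by_cases hρ : Function.Injective fun h => ((T.δ a q).2 h).1
    · obtain ⟨κ', F, hF⟩ := I.exists_tuple_step κ hρ fun h => ((T.δ a q).2 h).2
      refine ⟨((T.δ a q).1, fun h => σ ((T.δ a q).2 h).1, κ'), fun s => (s, 𝒜.map (𝒜.id _) F), ?_⟩
      rintro ⟨q', U⟩ V ⟨rfl, P, E, p, hp, hV, hU⟩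
      refine ⟨rfl, P, _, _, hF E p hp, fun s => ?_, fun h => ?_⟩
      · simp [transform, hV]
      · simp only at hU
        simp [step, transform, hU]
    · obtain ⟨x, hx⟩ : ∃ x, ∀ h, x ≠ ((T.δ a q).2 h).1 := by
        rw [Finite.injective_iff_surjective] at hρ
        simpa [Function.Surjective, eq_comm] using hρ
      choose ν hν using fun h => Fin.exists_succAbove_eq (hx h).symm
      choose F hF using fun s => I.exists_evalAt κ (List.mem_finRange (x.succAbove s))
      obtain ⟨p', hp'⟩ := I.exists_tuple_const fun h => ((T.δ a q).2 h).2
      let G : 𝒜.Hom T.M (𝒜.tensor T.M (pow I.B (List.finRange (n + 2)))) :=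
        𝒜.comp (𝒜.comp (𝒜.unitorInv _) (𝒜.swap _ _)) (𝒜.map (𝒜.id _) (𝒜.const p'))
      -- The old components other than `x`, which is no longer used, are evaluated into the new
      -- family, and the names restart from the current updates.
      refine ⟨((T.δ a q).1, ν, fun h => I.shape ((T.δ a q).2 h).2),
        fun s => (σ (x.succAbove s), 𝒜.comp (F s) G), ?_⟩
      rintro ⟨q', U⟩ V ⟨rfl, P, E, p, ⟨b, rfl, hb⟩, hV, hU⟩
      refine ⟨rfl, fun s => U (x.succAbove s), _, p', hp', fun s => ?_, fun h => ?_⟩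
      · simp only at hU
        simp only [transform, hV, 𝒜.act_comp, hF s _ b E hb, ← hU]
        simp [G]
      · simp [step, transform, hν]
  · rintro ⟨q, σ, κ⟩
    obtain ⟨F, hF⟩ := I.exists_evalAt κ (List.mem_finRange (T.o q).1)
    refine ⟨σ (T.o q).1, 𝒜.comp F (T.o q).2, ?_⟩
    rintro ⟨q', U⟩ V ⟨rfl, P, E, p, ⟨b, rfl, hb⟩, hV, hU⟩
    simp only at hU
    rw [hV, 𝒜.act_comp, hF _ b E hb, ← hU]
    rfl

/-- Additive families do not increase the expressive power of machines. -/
theorem FamilyMachine.exists_machine (N : ∀ M, 𝒜.Internal M) {H : Type*} [Finite H] [Nonempty H]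
    (T : 𝒜.FamilyMachine O α H) : ∃ T' : 𝒜.Machine O α, T'.eval = T.eval := by
  have key : ∀ n : ℕ, ∀ T : 𝒜.FamilyMachine O α (Fin (n + 1)),
      ∃ T' : 𝒜.Machine O α, T'.eval = T.eval := by
    intro n
    induction n with
    | zero =>
      intro T
      refine ⟨{ Q := T.Q, q₀ := T.q₀, M := T.M, i := 𝒜.act (T.j 0) T.i,
                δ := fun a q => ((T.δ a q).1, ((T.δ a q).2 0).2), o := fun q => (T.o q).2 },
        funext fun w => ?_⟩
      simp only [Machine.eval, FamilyMachine.eval]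
      generalize hc : List.foldl T.step T.init w = c
      rw [show List.foldl _ _ w = (c.1, c.2 0) from ?_]
      · simp [Machine.out, out, Fin.fin_one_eq_zero]
      · subst hc
        induction w using List.reverseRecOn with
        | nil => rfl
        | append_singleton w a ih =>
          simp only [List.foldl_append, List.foldl_cons, List.foldl_nil, ih]
          simp [Machine.step, step, transform, Fin.fin_one_eq_zero]
    | succ n ih =>
      intro T
      obtain ⟨T₁, h₁⟩ := T.exists_pred N
      obtain ⟨T₂, h₂⟩ := ih T₁
      exact ⟨T₂, h₂.trans h₁⟩
  obtain ⟨n, ⟨e⟩⟩ := Finite.exists_equiv_fin H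
  obtain _ | n := n
  · exact (e (Classical.arbitrary H)).elim0
  obtain ⟨T₁, h₁⟩ := T.exists_equiv e
  obtain ⟨T₂, h₂⟩ := key n T₁
  exact ⟨T₂, h₂.trans h₁⟩

end MemoryModel

/-! ### Copyless transitions -/

theorem countP_eq_count_wordVars {A R : Type*} [DecidableEq R] (w : List (A ⊕ R)) (r : R)
    [DecidablePred fun x : A ⊕ R => x = Sum.inr r] :
    w.countP (fun x => x = Sum.inr r) = (wordVars w).count r := by
  induction w with
  | nil => rfl
  | cons e w ih =>
    cases e with
    | inl a => simpa [List.countP_cons] using ih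
    | inr s => simp [List.countP_cons, List.count_cons, ih]

theorem registerCopyless_iff {Γ R S : Type*} [Fintype S] [DecidableEq R] {t : S → List (Γ ⊕ R)} :
    RegisterCopyless t ↔ ∀ r, ∑ s, (wordVars (t s)).count r ≤ 1 := by
  simp only [RegisterCopyless, countP_eq_count_wordVars]

theorem RegisterTransition.nodup_flatMap {Γ R S : Type*} [Fintype S] (t : RegisterTransition Γ R S) :
    (Finset.univ.toList.flatMap fun s => wordVars (t.1 s)).Nodup := by
  classical
  refine List.nodup_iff_count_le_one.2 fun r => ?_
  rw [List.count_flatMap]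
  simpa [Function.comp_def] using registerCopyless_iff.1 t.2 r

theorem List.exists_forall_mem_eq_of_nodup_map_fst {R Q : Type*} [Nonempty Q] {L : List (R × Q)}
    (hL : (L.map Prod.fst).Nodup) : ∃ h : R → Q, ∀ p ∈ L, h p.1 = p.2 := by
  classical
  refine ⟨fun r => if H : ∃ q, (r, q) ∈ L then H.choose else Classical.arbitrary Q, ?_⟩
  rintro ⟨r, q⟩ hp
  have H : ∃ q, (r, q) ∈ L := ⟨q, hp⟩
  have := List.inj_on_of_nodup_map hL H.choose_spec hp rfl
  simpa [H] using congrArg Prod.snd this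

namespace MemoryModel

/-! ### Runs of a machine on the contents of registers -/

variable {𝒜 : MemoryModel} {O : 𝒜.Obj} {α Γ R S : Type*}

namespace Machine

variable (T : 𝒜.Machine O Γ)

/-- The state reached from `q` after reading `u`. -/
def stateRun (u : List Γ) (q : T.Q) : T.Q := u.foldl (fun q a => (T.δ a q).1) q

/-- The effect on the memory of reading `u` from the state `q`. -/
def contentRun (u : List Γ) (q : T.Q) (y : 𝒜.Pt T.M) : 𝒜.Pt T.M := (u.foldl T.step (q, y)).2

theorem foldl_step (u : List Γ) (q : T.Q) (y : 𝒜.Pt T.M) :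
    u.foldl T.step (q, y) = (T.stateRun u q, T.contentRun u q y) := by
  refine Prod.ext ?_ rfl
  induction u generalizing q y with
  | nil => rfl
  | cons a u ih => exact ih _ _

theorem stateRun_append (u v : List Γ) (q : T.Q) :
    T.stateRun (u ++ v) q = T.stateRun v (T.stateRun u q) := List.foldl_append

theorem contentRun_append (u v : List Γ) (q : T.Q) (y : 𝒜.Pt T.M) :
    T.contentRun (u ++ v) q y = T.contentRun v (T.stateRun u q) (T.contentRun u q y) := by
  have h : (u ++ v).foldl T.step (q, y) = v.foldl T.step (u.foldl T.step (q, y)) :=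
    List.foldl_append
  rw [T.foldl_step u q y] at h
  exact congrArg Prod.snd h

/-- The state reached from `q` after reading a word with registers, when reading the content of the
register `r` acts on states as `ψ r`. -/
def wordState (ψ : R → T.Q → T.Q) : List (Γ ⊕ R) → T.Q → T.Q
  | [], q => q
  | Sum.inl c :: w, q => wordState ψ w (T.δ c q).1
  | Sum.inr r :: w, q => wordState ψ w (ψ r q)

/-- The word of memory updates performed when reading a word with registers from the state `q`. The
variable `(r, q)` stands for the effect of reading the content of `r` from `q`. -/
def translate (ψ : R → T.Q → T.Q) : List (Γ ⊕ R) → T.Q → List (𝒜.Hom T.M T.M ⊕ (R × T.Q))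
  | [], _ => []
  | Sum.inl c :: w, q => Sum.inl (T.δ c q).2 :: translate ψ w (T.δ c q).1
  | Sum.inr r :: w, q => Sum.inr (r, q) :: translate ψ w (ψ r q)

theorem map_fst_wordVars_translate (ψ : R → T.Q → T.Q) (w : List (Γ ⊕ R)) (q : T.Q) :
    (wordVars (T.translate ψ w q)).map Prod.fst = wordVars w := by
  induction w generalizing q with
  | nil => rfl
  | cons e w ih => cases e <;> simp [translate, ih]

theorem stateRun_flatMap (x : R → List Γ) (w : List (Γ ⊕ R)) (q : T.Q) :
    T.stateRun (w.flatMap (Sum.elim (fun c => [c]) x)) q =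
      T.wordState (fun r => T.stateRun (x r)) w q := by
  induction w generalizing q with
  | nil => rfl
  | cons e w ih =>
    rw [List.flatMap_cons, stateRun_append, ih]
    cases e <;> rfl

theorem contentRun_flatMap (x : R → List Γ) (w : List (Γ ⊕ R)) (q : T.Q) :
    T.contentRun (w.flatMap (Sum.elim (fun c => [c]) x)) q =
      Internal.denote (fun p : R × T.Q => T.contentRun (x p.1) p.2)
        (T.translate (fun r => T.stateRun (x r)) w q) := by
  induction w generalizing q with
  | nil => rfl
  | cons e w ih =>
    funext y
    rw [List.flatMap_cons, contentRun_append, ih]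
    cases e <;> rfl

/-! ### Precomposition with a copyless streaming string transducer -/

/-- The effect of a copyless register transition on the runs of a machine over the registers. Once
the state from which each new register will be read is chosen, each old register needs to be read
from a single state, because it is used at most once. -/
theorem exists_transition (N : 𝒜.Internal T.M) [Fintype R] [Fintype S] (ψ : R → T.Q → T.Q)
    (κ : R × T.Q → N.K) (t : RegisterTransition Γ R S) (h' : S → T.Q) :
    ∃ (h : R → T.Q) (F : 𝒜.Hom (pow N.B (Finset.univ : Finset R).toList)
        (pow N.B (Finset.univ : Finset S).toList)),
      ∀ (x : R → List Γ) (b : R → 𝒜.Pt N.B), (ψ = fun r => T.stateRun (x r)) →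
        (∀ r, N.Rep (κ (r, h r)) (b r) (T.contentRun (x r) (h r))) →
        ∃ b' : S → 𝒜.Pt N.B, 𝒜.act F (tup b Finset.univ.toList) = tup b' Finset.univ.toList ∧
          ∀ s, N.Rep (N.wordShape κ (T.translate ψ (t.1 s) (h' s))) (b' s)
            (T.contentRun (t.act x s) (h' s)) := by
  have : Nonempty T.Q := ⟨T.q₀⟩
  have hmap : ((Finset.univ.toList.flatMap fun s =>
      wordVars (T.translate ψ (t.1 s) (h' s))).map Prod.fst).Nodup := by
    simpa only [List.map_flatMap, map_fst_wordVars_translate] using t.nodup_flatMap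
  obtain ⟨h, hh⟩ := List.exists_forall_mem_eq_of_nodup_map_fst hmap
  obtain ⟨F, hF⟩ := N.exists_words κ Prod.fst (fun s => T.translate ψ (t.1 s) (h' s))
    Finset.univ.toList Finset.univ.toList (hmap.subperm fun r _ => by simp)
  refine ⟨h, F, fun x b hψ hb => ?_⟩
  obtain ⟨b', h₁, h₂⟩ := hF b (fun p => T.contentRun (x p.1) p.2) (fun r => ⟨_, _, hb r⟩) <| by
    rintro s hs ⟨r, q⟩ hj
    have : h r = q := hh (r, q) (List.mem_flatMap.2 ⟨s, hs, hj⟩)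
    subst this
    exact hb r
  refine ⟨b', h₁, fun s => ?_⟩
  rw [RegisterTransition.act, contentRun_flatMap, ← hψ]
  exact h₂ s (by simp)

/-- Functions computed by machines over a model with internalizations are closed under
precomposition by regular functions. The memory consists of one name for each register. A component
of the family chooses for each register a state `h r`, and its names describe the effect of reading
the content of `r` from `h r`. -/
theorem exists_comp (N : ∀ M, 𝒜.Internal M) (G : CopylessSST α Γ) :
    ∃ T' : 𝒜.Machine O α, T'.eval = T.eval ∘ G.eval := by
  have : Nonempty T.Q := ⟨T.q₀⟩
  let I := N T.M
  suffices ∃ T' : 𝒜.FamilyMachine O α (G.R → T.Q), T'.eval = T.eval ∘ G.eval by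
    obtain ⟨T₁, h₁⟩ := this
    obtain ⟨T₂, h₂⟩ := T₁.exists_machine N
    exact ⟨T₂, h₂.trans h₁⟩
  refine exists_familyMachine_of_simulation (G.q₀, G.i.act Empty.elim) G.step
    (fun c => T.eval ((G.o c.1).act c.2 ())) (Z := G.Q × (G.R → T.Q → T.Q) × (G.R × T.Q → I.K))
    (pow I.B (Finset.univ : Finset G.R).toList)
    (fun c z V => c.1 = z.1 ∧ (z.2.1 = fun r => T.stateRun (c.2 r)) ∧
      ∀ h : G.R → T.Q, ∃ b : G.R → 𝒜.Pt I.B, V h = tup b Finset.univ.toList ∧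
        ∀ r, I.Rep (z.2.2 (r, h r)) (b r) (T.contentRun (c.2 r) (h r))) ?_ ?_ ?_
  · let κ₀ : Empty × T.Q → I.K := fun p => p.1.elim
    let ψ₀ : Empty → T.Q → T.Q := Empty.elim
    choose h₀ F hF using T.exists_transition I ψ₀ κ₀ G.i
    -- The initial contents do not depend on the seed, which is erased.
    obtain ⟨D, hD⟩ := I.exists_sublist (List.nil_sublist (Finset.univ : Finset G.R).toList)
    let e : Empty → 𝒜.Pt I.B := Empty.elim
    refine ⟨(G.q₀, fun s => T.stateRun (G.i.act Empty.elim s),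
      fun p => I.wordShape κ₀ (T.translate ψ₀ (G.i.1 p.1) p.2)),
      tup (fun _ => I.name (𝒜.id _)) Finset.univ.toList,
      fun h => 𝒜.comp (𝒜.comp D (𝒜.const (tup e Finset.univ.toList))) (F h), rfl, rfl, fun h => ?_⟩
    obtain ⟨b', h₁, h₂⟩ := hF h Empty.elim e (funext fun r => r.elim) fun r => r.elim
    refine ⟨b', ?_, h₂⟩
    beta_reduce
    rw [𝒜.act_comp, 𝒜.act_comp, hD _ fun _ => ⟨_, _, I.rep_name _⟩, ← h₁]
    exact congrArg _ (𝒜.act_const _)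
  · rintro a ⟨p, ψ, κ⟩
    choose ρ F hF using T.exists_transition I ψ κ (G.δ a p).2
    refine ⟨((G.δ a p).1, fun s => T.wordState ψ ((G.δ a p).2.1 s),
      fun r => I.wordShape κ (T.translate ψ ((G.δ a p).2.1 r.1) r.2)), fun h => (ρ h, F h), ?_⟩
    rintro ⟨p', x⟩ V ⟨rfl, hψ, hV⟩
    refine ⟨rfl, ?_, fun h => ?_⟩
    · funext s q
      simp only at hψ
      simp [CopylessSST.step, RegisterTransition.act, stateRun_flatMap, hψ]
    · obtain ⟨b, hb, hr⟩ := hV (ρ h)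
      obtain ⟨b', h₁, h₂⟩ := hF h x b hψ hr
      exact ⟨b', by simpa [FamilyMachine.transform, hb] using h₁, h₂⟩
  · rintro ⟨p, ψ, κ⟩
    obtain ⟨h, F, hF⟩ := T.exists_transition I ψ κ (G.o p) fun _ => T.q₀
    obtain ⟨E, hE⟩ := I.exists_evalAt
      (fun s => I.wordShape κ (T.translate ψ ((G.o p).1 s) T.q₀))
      (l := Finset.univ.toList) (i := ()) (by simp)
    refine ⟨h, 𝒜.comp (𝒜.comp (𝒜.comp (𝒜.unitorInv _) (𝒜.map (𝒜.const T.i) F)) E)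
      (T.o (T.wordState ψ ((G.o p).1 ()) T.q₀)), ?_⟩
    rintro ⟨p', x⟩ V ⟨rfl, hψ, hV⟩
    obtain ⟨b, hb, hr⟩ := hV h
    obtain ⟨b', h₁, h₂⟩ := hF x b hψ hr
    simp only at hψ
    simp [hb, h₁, hE _ b' _ h₂, eval, foldl_step, out, RegisterTransition.act, stateRun_flatMap, hψ]

end Machine

end MemoryModel

namespace MemoryModel

/-! ### The memory model of a symmetric monoidal closed quasi-affine category -/

section Category

universe v u

variable {C : Type u} [Category.{v} C] [MonoidalCategory C]

/-- The tensor product of two points of a monoidal category. -/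
def tensorPoint {M N : C} (x : 𝟙_ C ⟶ M) (y : 𝟙_ C ⟶ N) : 𝟙_ C ⟶ M ⊗ N :=
  (λ_ (𝟙_ C)).inv ≫ (x ⊗ₘ y)

theorem tensorPoint_map {M M' N N' : C} (x : 𝟙_ C ⟶ M) (y : 𝟙_ C ⟶ N) (f : M ⟶ M') (g : N ⟶ N') :
    tensorPoint x y ≫ (f ⊗ₘ g) = tensorPoint (x ≫ f) (y ≫ g) := by
  simp [tensorPoint]

theorem tensorPoint_braiding [BraidedCategory C] {M N : C} (x : 𝟙_ C ⟶ M) (y : 𝟙_ C ⟶ N) :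
    tensorPoint x y ≫ (β_ M N).hom = tensorPoint y x := by
  simp [tensorPoint, ← unitors_equal]

theorem tensorPoint_associator {M N P : C} (x : 𝟙_ C ⟶ M) (y : 𝟙_ C ⟶ N) (z : 𝟙_ C ⟶ P) :
    tensorPoint (tensorPoint x y) z ≫ (α_ M N P).hom = tensorPoint x (tensorPoint y z) := by
  have h : (λ_ (𝟙_ C)).inv ≫ (λ_ (𝟙_ C)).inv ▷ 𝟙_ C ≫ (α_ _ _ _).hom =
      (λ_ (𝟙_ C)).inv ≫ 𝟙_ C ◁ (λ_ (𝟙_ C)).inv := by monoidal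
  have e₁ : tensorPoint x y ⊗ₘ z = (λ_ (𝟙_ C)).inv ▷ 𝟙_ C ≫ ((x ⊗ₘ y) ⊗ₘ z) := by
    rw [tensorPoint, ← MonoidalCategory.tensorHom_id, tensorHom_comp_tensorHom, Category.id_comp]
  have e₂ : x ⊗ₘ tensorPoint y z = 𝟙_ C ◁ (λ_ (𝟙_ C)).inv ≫ (x ⊗ₘ (y ⊗ₘ z)) := by
    rw [tensorPoint, ← MonoidalCategory.id_tensorHom, tensorHom_comp_tensorHom, Category.id_comp]
  rw [tensorPoint, e₁, tensorPoint.eq_1 x, e₂, ← reassoc_of% h]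
  simp only [Category.assoc, associator_naturality]

theorem tensorPoint_unitor {M : C} (x : 𝟙_ C ⟶ M) : tensorPoint (𝟙 _) x ≫ (λ_ M).hom = x := by
  simp [tensorPoint]

variable (C) in
/-- The memory model of a symmetric monoidal category: points are the morphisms from the unit. -/
def ofCategory [SymmetricCategory C] : MemoryModel where
  Obj := C
  Hom M N := M ⟶ N
  Pt M := 𝟙_ C ⟶ M
  act f x := x ≫ f
  id M := 𝟙 M
  act_id x := Category.comp_id x
  comp f g := f ≫ g
  act_comp f g x := (Category.assoc x f g).symm
  unit := 𝟙_ C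
  star := 𝟙 _
  const x := x
  act_const x := Category.id_comp x
  tensor M N := M ⊗ N
  pair x y := tensorPoint x y
  map f g := f ⊗ₘ g
  act_map f g x y := tensorPoint_map x y f g
  swap M N := (β_ M N).hom
  act_swap x y := tensorPoint_braiding x y
  assoc M N P := (α_ M N P).hom
  act_assoc x y z := tensorPoint_associator x y z
  assocInv M N P := (α_ M N P).inv
  act_assocInv x y z := (Iso.comp_inv_eq _).2 (tensorPoint_associator x y z).symm
  unitor M := (λ_ M).hom
  act_unitor x := tensorPoint_unitor x
  unitorInv M := (λ_ M).inv
  act_unitorInv x := (Iso.comp_inv_eq _).2 (tensorPoint_unitor x).symm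

open Limits MonoidalClosed

section Names

variable [MonoidalClosed C] {M : C} [HasBinaryProduct ((ihom M).obj M) (𝟙_ C)]

/-- The name of an endomorphism `f` of `M`, as a point of `(M ⊸ M) × 𝟙`. -/
noncomputable def closedName (f : M ⟶ M) : 𝟙_ C ⟶ (ihom M).obj M ⨯ 𝟙_ C :=
  prod.lift (curry' f) (𝟙 _)

theorem closedName_fst (f : M ⟶ M) : closedName f ≫ prod.fst = curry' f := prod.lift_fst _ _

theorem closedName_snd (f : M ⟶ M) : closedName f ≫ prod.snd = 𝟙 _ := prod.lift_snd _ _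

variable (M) in
/-- Composition of names. -/
noncomputable def closedComp : ((ihom M).obj M ⨯ 𝟙_ C) ⊗ ((ihom M).obj M ⨯ 𝟙_ C) ⟶
    (ihom M).obj M ⨯ 𝟙_ C :=
  prod.lift ((prod.fst ⊗ₘ prod.fst) ≫ MonoidalClosed.comp M M M)
    ((prod.snd ⊗ₘ prod.snd) ≫ (λ_ _).hom)

theorem tensorPoint_closedComp (f g : M ⟶ M) :
    tensorPoint (closedName f) (closedName g) ≫ closedComp M = closedName (f ≫ g) := by
  ext
  · rw [Category.assoc, closedComp, prod.lift_fst, ← Category.assoc, tensorPoint_map]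
    simp only [closedName_fst, curry'_comp, tensorPoint, Category.assoc]
  · rw [Category.assoc, closedComp, prod.lift_snd, ← Category.assoc, tensorPoint_map]
    simp only [closedName_snd, tensorPoint_unitor]

theorem tensorPoint_ev (x : 𝟙_ C ⟶ M) (f : M ⟶ M) :
    tensorPoint x (closedName f) ≫ (𝟙 M ⊗ₘ prod.fst) ≫ (ihom.ev M).app M = x ≫ f := by
  rw [← Category.assoc, tensorPoint_map, closedName_fst, tensorPoint,
    MonoidalCategory.tensorHom_def, Category.assoc, Category.assoc, whiskerLeft_curry'_ihom_ev_app]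
  simp [← unitors_equal]

end Names

/-- In a symmetric monoidal closed quasi-affine category, the maps induced by endomorphisms of `M`
are named by the points of `(M ⊸ M) × 𝟙` whose second component is the identity: this component
allows names to be erased. -/
noncomputable def internalOfClosed [SymmetricCategory C] [MonoidalClosed C] (hC : QuasiAffine C)
    (M : C) : (ofCategory C).Internal M :=
  have : HasBinaryProduct ((ihom M).obj M) (𝟙_ C) := hC _
  { K := Unit
    B := ((ihom M).obj M ⨯ 𝟙_ C : C)
    Rep := fun _ b φ => ∃ f : M ⟶ M, b = closedName f ∧ φ = fun x => x ≫ f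
    shape := fun _ => ()
    name := fun f => closedName f
    rep_name := fun f => ⟨f, rfl, rfl⟩
    mul := fun _ _ => ()
    comp := fun _ _ => closedComp M
    rep_comp := by
      rintro _ _ _ _ _ _ ⟨f, rfl, rfl⟩ ⟨g, rfl, rfl⟩
      exact ⟨f ≫ g, tensorPoint_closedComp f g, funext fun x => Category.assoc x f g⟩
    ev := fun _ => (𝟙 M ⊗ₘ prod.fst) ≫ (ihom.ev M).app M
    act_ev := by
      rintro _ _ _ x ⟨f, rfl, rfl⟩
      exact tensorPoint_ev x f
    disc := (prod.snd : (ihom M).obj M ⨯ 𝟙_ C ⟶ 𝟙_ C)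
    act_disc := by
      rintro _ _ _ ⟨f, rfl, rfl⟩
      exact closedName_snd f }

theorem _root_.StreamingSetting.Computes.comp_isRegularFunction [SymmetricCategory C]
    [MonoidalClosed C] {X : Type*} {𝔖 : StreamingSetting C X} (hC : QuasiAffine C)
    (h𝔖 : 𝔖.start = 𝟙_ C) {α Γ : Type*} {f : List Γ → X} {g : List α → List Γ}
    (hf : 𝔖.Computes f) (hg : IsRegularFunction g) : 𝔖.Computes (f ∘ g) := by
  obtain ⟨start, final, interp⟩ := 𝔖
  simp only at h𝔖
  subst h𝔖
  obtain ⟨⟨Q, q₀, R, δ, i, o⟩, rfl⟩ := hf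
  obtain ⟨G, rfl⟩ := hg
  let T : (ofCategory C).Machine final Γ :=
    { Q := Q, q₀ := q₀, M := R, i := i, δ := δ, o := o }
  obtain ⟨⟨Q', q₀', R', i', δ', o'⟩, hT'⟩ := T.exists_comp (internalOfClosed (C := C) hC) G
  refine ⟨{ Q := Q', q₀ := q₀', R := R', δ := δ', i := i', o := o' }, ?_⟩
  exact funext fun w => congrArg interp (congrFun hT' w)

end Category

end MemoryModel

/-! ### Copyless families of words -/

/-- A family of words is copyless when each word has no repeated variable and no two words share a
variable. -/
theorem registerCopyless_iff_nodup {Γ R S : Type*} [Fintype S] {t : S → List (Γ ⊕ R)} :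
    RegisterCopyless t ↔ (∀ s, (wordVars (t s)).Nodup) ∧
      ∀ s s' r, r ∈ wordVars (t s) → r ∈ wordVars (t s') → s = s' := by
  classical
  constructor
  · intro h
    have : Std.Symm (Function.onFun List.Disjoint fun s => wordVars (t s)) := ⟨fun _ _ h => h.symm⟩
    have := List.nodup_flatMap.1 (RegisterTransition.nodup_flatMap ⟨t, h⟩)
    refine ⟨fun s => this.1 s (by simp), fun s s' r h₁ h₂ => by_contra fun hs => ?_⟩
    exact this.2.forall (by simp) (by simp) hs h₁ h₂
  · rintro ⟨h₁, h₂⟩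
    refine registerCopyless_iff.2 fun r => ?_
    by_cases hr : ∃ s, r ∈ wordVars (t s)
    · obtain ⟨s, hs⟩ := hr
      rw [Finset.sum_eq_single s]
      · exact List.nodup_iff_count_le_one.1 (h₁ s) r
      · exact fun s' _ hs' => List.count_eq_zero.2 fun h => hs' (h₂ _ _ _ h hs)
      · simp
    · push Not at hr
      simp [List.count_eq_zero.2 (hr _)]

theorem wordVars_flatMap {Γ R S : Type*} (w : List (Γ ⊕ S)) (t : S → List (Γ ⊕ R)) :
    wordVars (w.flatMap (Sum.elim (fun c => [Sum.inl c]) t)) =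
      (wordVars w).flatMap fun s => wordVars (t s) := by
  induction w with
  | nil => rfl
  | cons e w ih =>
    have h : ∀ u v : List (Γ ⊕ R), wordVars (u ++ v) = wordVars u ++ wordVars v :=
      fun u v => List.filterMap_append
    rw [List.flatMap_cons, h, ih]
    cases e <;> simp

theorem wordVars_map {Γ R S : Type*} (w : List (Γ ⊕ R)) (f : R → S) :
    wordVars (w.map (Sum.map id f)) = (wordVars w).map f := by
  induction w with
  | nil => rfl
  | cons e w ih => cases e <;> simp [ih]

/-! ### Cutting words at variables -/

section Segments

variable {Γ R Y : Type*}

/-- The sequence of variables from `R` in a word with two kinds of variables. -/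
def leftVars (w : List (Γ ⊕ (R ⊕ Y))) : List R := (wordVars w).filterMap Sum.getLeft?

theorem mem_leftVars {w : List (Γ ⊕ (R ⊕ Y))} {r : R} :
    r ∈ leftVars w ↔ Sum.inl r ∈ wordVars w := by
  simp [leftVars, List.mem_filterMap, Sum.getLeft?_eq_some_iff]

theorem nodup_leftVars {w : List (Γ ⊕ (R ⊕ Y))} (h : (wordVars w).Nodup) : (leftVars w).Nodup :=
  h.filterMap fun a b r ha hb => by
    simp only [Option.mem_def, Sum.getLeft?_eq_some_iff] at ha hb
    rw [ha, hb]

variable [DecidableEq R]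

/-- The segments of a word over letters, variables `R` and variables `Y`, cut at the variables from
`R`: the segment `none` precedes the first such variable, and the segment `some r` comes after the
first occurrence of `r`. -/
def wordSegment : Option R → List (Γ ⊕ (R ⊕ Y)) → List (Γ ⊕ Y)
  | _, [] => []
  | none, Sum.inl c :: w => Sum.inl c :: wordSegment none w
  | none, Sum.inr (Sum.inr y) :: w => Sum.inr y :: wordSegment none w
  | none, Sum.inr (Sum.inl _) :: _ => []
  | some r, Sum.inl _ :: w => wordSegment (some r) w
  | some r, Sum.inr (Sum.inr _) :: w => wordSegment (some r) w
  | some r, Sum.inr (Sum.inl r') :: w => if r = r' then wordSegment none w else wordSegment (some r) w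

/-- A word is recovered from its sequence of variables from `R` and its segments. -/
theorem flatMap_eq_wordSegments (x : R → List Γ) (y : Y → List Γ) (w : List (Γ ⊕ (R ⊕ Y)))
    (hw : (leftVars w).Nodup) :
    w.flatMap (Sum.elim (fun c => [c]) (Sum.elim x y)) =
      (wordSegment none w).flatMap (Sum.elim (fun c => [c]) y) ++ (leftVars w).flatMap fun r =>
        x r ++ (wordSegment (some r) w).flatMap (Sum.elim (fun c => [c]) y) := by
  induction w with
  | nil => simp [wordSegment, leftVars]
  | cons e w ih =>
    rcases e with c | r | z
    · simpa [wordSegment, leftVars] using ih (by simpa [leftVars] using hw)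
    · have h : leftVars (Sum.inr (Sum.inl r) :: w) = r :: leftVars w := by simp [leftVars]
      rw [h] at hw ⊢
      rw [List.flatMap_cons, ih hw.of_cons, List.flatMap_cons]
      simp only [Sum.elim_inr, Sum.elim_inl, wordSegment, if_true, List.flatMap_nil, List.nil_append,
        List.append_assoc]
      congr 2
      refine List.flatMap_congr fun r' hr' => ?_
      rw [if_neg]
      rintro rfl
      exact (List.nodup_cons.1 hw).1 hr'
    · have h : leftVars (Sum.inr (Sum.inr z) :: w) = leftVars w := rfl
      rw [h] at hw ⊢
      simpa [wordSegment] using ih hw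

theorem wordVars_wordSegment_sublist (o : Option R) (w : List (Γ ⊕ (R ⊕ Y))) :
    ((wordVars (wordSegment o w)).map Sum.inr).Sublist (wordVars w) := by
  induction w generalizing o with
  | nil => cases o <;> simp [wordSegment]
  | cons e w ih =>
    rcases e with c | r | z <;> rcases o with _ | r' <;> simp only [wordSegment]
    · exact ih none
    · exact ih _
    · simp
    · split_ifs <;> exact (ih _).trans (List.sublist_cons_self _ _)
    · simpa using ih none
    · exact (ih _).trans (List.sublist_cons_self _ _)

theorem mem_wordVars_of_mem_wordSegment {o : Option R} {w : List (Γ ⊕ (R ⊕ Y))} {y : Y}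
    (h : y ∈ wordVars (wordSegment o w)) : Sum.inr y ∈ wordVars w :=
  (wordVars_wordSegment_sublist o w).subset (List.mem_map_of_mem h)

theorem wordSegment_unique {o o' : Option R} {w : List (Γ ⊕ (R ⊕ Y))} {y : Y} (hw : (wordVars w).Nodup)
    (h : y ∈ wordVars (wordSegment o w)) (h' : y ∈ wordVars (wordSegment o' w)) : o = o' := by
  induction w generalizing o o' with
  | nil => cases o <;> simp [wordSegment] at h
  | cons e w ih =>
    rcases e with c | r | z
    · rcases o with _ | r₁ <;> rcases o' with _ | r₂ <;> simp only [wordSegment] at h h' <;>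
        exact ih hw h h'
    · have hw' := hw.of_cons
      rcases o with _ | r₁ <;> rcases o' with _ | r₂ <;> simp only [wordSegment] at h h'
      · simp at h
      · simp at h
      · simp at h'
      · split_ifs at h h' with h₁ h₂ h₂
        · rw [h₁, h₂]
        · cases ih hw' h h'
        · cases ih hw' h h'
        · exact ih hw' h h'
    · have hz := List.nodup_cons.1 hw
      rcases o with _ | r₁ <;> rcases o' with _ | r₂ <;>
        simp only [wordSegment, wordVars_inr, List.mem_cons] at h h'
      · rfl
      · rcases h with rfl | h
        · exact absurd (mem_wordVars_of_mem_wordSegment h') hz.1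
        · exact ih hz.2 h h'
      · rcases h' with rfl | h'
        · exact absurd (mem_wordVars_of_mem_wordSegment h) hz.1
        · exact ih hz.2 h h'
      · exact ih hz.2 h h'

end Segments

/-! ### The memory model of register transitions -/

namespace RegisterTransition

variable {Γ R S U R' S' : Type*} [Fintype S] [Fintype U] [Fintype S']

/-- The transition in which the new register `s` takes the content of the old register `e s`. -/
def rename (e : S → R) (he : Function.Injective e) : RegisterTransition Γ R S :=
  ⟨fun s => [Sum.inr (e s)], registerCopyless_iff_nodup.2
    ⟨fun s => by simp, fun s s' r h₁ h₂ => he (by simp_all)⟩⟩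

@[simp] theorem rename_act (e : S → R) (he : Function.Injective e) (x : R → List Γ) :
    (rename e he).act x = x ∘ e := by
  funext s
  simp [rename, act]

/-- Composition of register transitions, in diagrammatic order. -/
def comp (t : RegisterTransition Γ R S) (u : RegisterTransition Γ S U) : RegisterTransition Γ R U :=
  ⟨fun a => (u.1 a).flatMap (Sum.elim (fun c => [Sum.inl c]) t.1), by
    have ht := registerCopyless_iff_nodup.1 t.2
    have hu := registerCopyless_iff_nodup.1 u.2
    refine registerCopyless_iff_nodup.2 ⟨fun a => ?_, fun a a' r => ?_⟩
    · rw [wordVars_flatMap, List.nodup_flatMap]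
      refine ⟨fun s _ => ht.1 s, (hu.1 a).imp ?_⟩
      exact fun hs r h₁ h₂ => hs (ht.2 _ _ _ h₁ h₂)
    · simp only [wordVars_flatMap, List.mem_flatMap]
      rintro ⟨s, hs, hr⟩ ⟨s', hs', hr'⟩
      obtain rfl := ht.2 _ _ _ hr hr'
      exact hu.2 _ _ _ hs hs'⟩

@[simp] theorem comp_act (t : RegisterTransition Γ R S) (u : RegisterTransition Γ S U)
    (x : R → List Γ) : (t.comp u).act x = u.act (t.act x) := by
  funext a
  simp only [comp, act, List.flatMap_assoc]
  congr 1
  funext e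
  cases e <;> simp [act]

/-- The transition from no register with given new contents. -/
def const (x : S → List Γ) : RegisterTransition Γ Empty S :=
  ⟨fun s => (x s).map Sum.inl, fun r => r.elim⟩

@[simp] theorem const_act (x : S → List Γ) (e : Empty → List Γ) : (const x).act e = x := by
  funext s
  simp [const, act, List.flatMap_map]

/-- Transitions acting side by side on disjoint sets of registers. -/
def map (t : RegisterTransition Γ R S) (u : RegisterTransition Γ R' S') :
    RegisterTransition Γ (R ⊕ R') (S ⊕ S') :=
  ⟨Sum.elim (fun s => (t.1 s).map (Sum.map id Sum.inl)) fun s => (u.1 s).map (Sum.map id Sum.inr), by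
    have ht := registerCopyless_iff_nodup.1 t.2
    have hu := registerCopyless_iff_nodup.1 u.2
    refine registerCopyless_iff_nodup.2 ⟨?_, ?_⟩
    · rintro (s | s)
      · simpa [wordVars_map] using (ht.1 s).map Sum.inl_injective
      · simpa [wordVars_map] using (hu.1 s).map Sum.inr_injective
    · rintro (s | s) (s' | s') (r | r) <;> simp [wordVars_map]
      · exact ht.2 _ _ _
      · exact hu.2 _ _ _⟩

@[simp] theorem map_act (t : RegisterTransition Γ R S) (u : RegisterTransition Γ R' S')
    (x : R → List Γ) (y : R' → List Γ) :
    (t.map u).act (Sum.elim x y) = Sum.elim (t.act x) (u.act y) := by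
  funext s
  cases s <;> simp only [map, act, Sum.elim_inl, Sum.elim_inr, List.flatMap_map] <;> congr 1 <;>
    funext e <;> cases e <;> rfl

/-! ### Internalization of register transitions -/

/-- The shapes of register transitions from `R` to itself: what remains of them once all letters are
erased. -/
def Shape (R : Type*) :=
  {k : R → List R // (∀ s, (k s).Nodup) ∧ ∀ s s' r, r ∈ k s → r ∈ k s' → s = s'}

instance [Finite R] : Finite (Shape R) := by
  classical
  have := Fintype.ofFinite R
  let e : Shape R → R → {l : List R // l.Nodup} := fun k s => ⟨k.1 s, k.2.1 s⟩
  refine Finite.of_injective e fun k k' h => Subtype.ext (funext fun s => ?_)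
  exact congrArg Subtype.val (congrFun h s)

variable {Y : Type*}

/-- The shape of a transition with auxiliary registers `Y`, which are erased like letters. -/
def shape (t : RegisterTransition Γ (S ⊕ Y) S) : Shape S :=
  ⟨fun s => leftVars (t.1 s), fun s => nodup_leftVars ((registerCopyless_iff_nodup.1 t.2).1 s),
    fun s s' _ h h' => (registerCopyless_iff_nodup.1 t.2).2 s s' _
      (mem_leftVars.1 h) (mem_leftVars.1 h')⟩

open Classical in
/-- The segments of a transition: `(s, none)` is the beginning of the new content of `s`, and
`(s, some r)` is what follows the old content of `r` in the new content of `s`. -/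
noncomputable def curry (t : RegisterTransition Γ (S ⊕ Y) S) : RegisterTransition Γ Y (S × Option S) :=
  ⟨fun p => wordSegment p.2 (t.1 p.1), by
    have ht := registerCopyless_iff_nodup.1 t.2
    refine registerCopyless_iff_nodup.2 ⟨fun p => ?_, ?_⟩
    · exact ((wordVars_wordSegment_sublist p.2 (t.1 p.1)).nodup (ht.1 p.1)).of_map _
    · rintro ⟨s, o⟩ ⟨s', o'⟩ y h h'
      obtain rfl := ht.2 s s' _ (mem_wordVars_of_mem_wordSegment h) (mem_wordVars_of_mem_wordSegment h')
      exact congrArg _ (wordSegment_unique (ht.1 s) h h')⟩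

/-- The transition that interleaves registers with segments, according to a shape. -/
def eval (k : Shape S) : RegisterTransition Γ (S ⊕ (S × Option S)) S :=
  ⟨fun s => Sum.inr (Sum.inr (s, none)) ::
      (k.1 s).flatMap fun r => [Sum.inr (Sum.inl r), Sum.inr (Sum.inr (s, some r))], by
    have h : ∀ s (l : List S), wordVars (l.flatMap fun r =>
        [(Sum.inr (Sum.inl r) : Γ ⊕ (S ⊕ (S × Option S))), Sum.inr (Sum.inr (s, some r))]) =
        l.flatMap fun r => [Sum.inl r, Sum.inr (s, some r)] := by
      intro s l
      induction l with
      | nil => rfl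
      | cons r l ih => simp [ih]
    refine registerCopyless_iff_nodup.2 ⟨fun s => ?_, ?_⟩
    · rw [wordVars_inr, h, List.nodup_cons, List.nodup_flatMap]
      refine ⟨by simp, by simp, (k.2.1 s).imp fun hne => ?_⟩
      simp [Function.onFun, hne.symm]
    · rintro s s' (r | ⟨r, o⟩)
      · simpa [h] using k.2.2 s s' r
      · simp only [wordVars_inr, h, List.mem_cons, List.mem_flatMap]
        simp
        grind⟩

theorem eval_curry_act (t : RegisterTransition Γ (S ⊕ Y) S) (x : S → List Γ) (y : Y → List Γ) :
    (eval t.shape).act (Sum.elim x (t.curry.act y)) = t.act (Sum.elim x y) := by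
  classical
  funext s
  have h := flatMap_eq_wordSegments x y (t.1 s) (t.shape.2.1 s)
  simp only [act]
  rw [h]
  simp [eval, List.flatMap_cons, List.flatMap_assoc, curry, shape, act]

/-- A transition, seen as one with no auxiliary register. -/
def addEmpty (f : RegisterTransition Γ S S) : RegisterTransition Γ (S ⊕ Empty) S :=
  (rename Sum.inl Sum.inl_injective).comp f

theorem addEmpty_act (f : RegisterTransition Γ S S) (x : S → List Γ) (e : Empty → List Γ) :
    (addEmpty f).act (Sum.elim x e) = f.act x := by
  simp [addEmpty]

/-- The composite of two transitions given by their shapes, their segments being stored in two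
groups of auxiliary registers. -/
def evalComp (k l : Shape S) :
    RegisterTransition Γ (S ⊕ ((S × Option S) ⊕ (S × Option S))) S :=
  ((rename (Equiv.sumAssoc _ _ _) (Equiv.injective _)).comp
    ((eval k).map (rename id Function.injective_id))).comp (eval l)

theorem evalComp_act (k l : Shape S) (x : S → List Γ) (b c : S × Option S → List Γ) :
    (evalComp k l).act (Sum.elim x (Sum.elim b c)) =
      (eval l).act (Sum.elim ((eval k).act (Sum.elim x b)) c) := by
  have h : Sum.elim x (Sum.elim b c) ∘ Equiv.sumAssoc _ _ _ = Sum.elim (Sum.elim x b) c := by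
    funext s
    rcases s with (_ | _) | _ <;> rfl
  simp [evalComp, h]

end RegisterTransition

namespace MemoryModel

/-- A finite set of registers. -/
structure RegisterSet where
  /-- registers -/
  R : Type
  [fin : Fintype R]

attribute [instance] RegisterSet.fin

open RegisterTransition

/-- The memory model of copyless register transitions: points are register contents, and the tensor
product is the disjoint union of sets of registers. -/
def ofRegisters (Γ : Type*) : MemoryModel where
  Obj := RegisterSet
  Hom M N := RegisterTransition Γ M.R N.R
  Pt M := M.R → List Γ
  act t x := t.act x
  id M := rename _root_.id Function.injective_id
  act_id x := by simp
  comp t u := t.comp u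
  act_comp t u x := by simp
  unit := ⟨Empty⟩
  star := Empty.elim
  const x := RegisterTransition.const x
  act_const x := by simp
  tensor M N := ⟨M.R ⊕ N.R⟩
  pair x y := Sum.elim x y
  map t u := t.map u
  act_map t u x y := map_act t u x y
  swap M N := rename Sum.swap (Equiv.sumComm _ _).injective
  act_swap x y := (rename_act _ _ _).trans (by funext s; cases s <;> rfl)
  assoc M N P := rename (Equiv.sumAssoc _ _ _).symm (Equiv.injective _)
  act_assoc x y z := by funext s; rcases s with _ | _ | _ <;> simp
  assocInv M N P := rename (Equiv.sumAssoc _ _ _) (Equiv.injective _)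
  act_assocInv x y z := by funext s; rcases s with (_ | _) | _ <;> simp
  unitor M := rename Sum.inr Sum.inr_injective
  act_unitor x := by funext s; simp
  unitorInv M := rename (Equiv.emptySum Empty M.R) (Equiv.injective _)
  act_unitorInv x := by funext s; rcases s with s | s <;> [exact s.elim; simp]

/-- Register transitions are named by their segments, which can be stored in registers, together
with their shape, which takes finitely many values. -/
noncomputable def internalOfRegisters (Γ : Type*) (M : RegisterSet) :
    (ofRegisters Γ).Internal M :=
  { K := Shape M.R
    B := ⟨M.R × Option M.R⟩
    Rep := fun k b φ => φ = fun x => (eval k).act (Sum.elim x b)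
    shape := fun f => (addEmpty f).shape
    name := fun f => (addEmpty f).curry.act Empty.elim
    rep_name := fun f => funext fun x => by
      exact ((eval_curry_act (addEmpty f) x Empty.elim).trans (addEmpty_act f x _)).symm
    mul := fun k l => (evalComp k l).shape
    comp := fun k l => (evalComp k l).curry
    rep_comp := by
      rintro k l b c _ _ rfl rfl
      funext x
      exact ((eval_curry_act (evalComp k l) x (Sum.elim b c)).trans (evalComp_act k l x b c)).symm
    ev := fun k => eval k
    act_ev := by
      rintro k b _ x rfl
      rfl
    disc := (rename Empty.elim fun e => e.elim : RegisterTransition Γ _ Empty)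
    act_disc := fun _ => funext fun e => e.elim }

end MemoryModel

/-- This does not follow from the closed categorical case: the model of register transitions is not
that of a closed category, and the finitely many shapes of its names are used. -/
theorem IsRegularFunction.comp {α Γ Δ : Type*} {f : List Γ → List Δ} {g : List α → List Γ}
    (hf : IsRegularFunction f) (hg : IsRegularFunction g) : IsRegularFunction (f ∘ g) := by
  obtain ⟨F, rfl⟩ := hf
  obtain ⟨G, rfl⟩ := hg
  let T : (MemoryModel.ofRegisters Δ).Machine ⟨Unit⟩ Γ :=
    { Q := F.Q, q₀ := F.q₀, M := ⟨F.R⟩, i := F.i.act Empty.elim, δ := F.δ, o := F.o }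
  obtain ⟨⟨Q', q₀', ⟨R'⟩, i', δ', o'⟩, hT'⟩ := T.exists_comp (MemoryModel.internalOfRegisters Δ) G
  let T₁ : CopylessSST α Δ :=
    { Q := Q', q₀ := q₀', R := R', δ := δ', i := RegisterTransition.const i', o := o' }
  have hi : T₁.i.act Empty.elim = i' := RegisterTransition.const_act i' _
  refine ⟨T₁, funext fun w => Eq.trans ?_ (congrFun (congrFun hT' w) ())⟩
  rw [CopylessSST.eval, CopylessSST.config, hi]
  rfl

/-! ### Inverse images of regular languages -/

/-- The automaton for the inverse image stores the state of the transducer and, for each register,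
the effect of its content on the states of the given automaton. -/
theorem Language.IsRegular.preimage {α Γ : Type*} {L : Language Γ} {g : List α → List Γ}
    (hL : L.IsRegular) (hg : IsRegularFunction g) :
    Language.IsRegular ({w | g w ∈ L} : Language α) := by
  classical
  obtain ⟨σ, _, A, rfl⟩ := hL
  obtain ⟨G, rfl⟩ := hg
  have := Fintype.ofFinite G.Q
  -- The effect on states of a word with registers, given the effects of the registers.
  let run {R : Type} (ψ : R → σ → σ) (w : List (Γ ⊕ R)) (s : σ) : σ :=
    w.foldl (fun s e => Sum.elim (A.step s) (fun r => ψ r s) e) s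
  have hrun {R : Type} (x : R → List Γ) (w : List (Γ ⊕ R)) (s : σ) :
      A.evalFrom s (w.flatMap (Sum.elim (fun c => [c]) x)) =
        run (fun r s => A.evalFrom s (x r)) w s := by
    induction w generalizing s with
    | nil => rfl
    | cons e w ih =>
      rw [List.flatMap_cons, A.evalFrom_of_append, ih]
      cases e <;> rfl
  let abs (c : G.Q × (G.R → List Γ)) : G.Q × (G.R → σ → σ) :=
    (c.1, fun r s => A.evalFrom s (c.2 r))
  let D : DFA α (G.Q × (G.R → σ → σ)) :=
    { step := fun c a => ((G.δ a c.1).1, fun r => run c.2 ((G.δ a c.1).2.1 r))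
      start := abs (G.q₀, G.i.act Empty.elim)
      accept := {c | run c.2 ((G.o c.1).1 ()) A.start ∈ A.accept} }
  refine ⟨_, inferInstance, D, ?_⟩
  have hD : ∀ w, D.eval w = abs (G.config w) := by
    intro w
    induction w using List.reverseRecOn with
    | nil => rfl
    | append_singleton w a ih =>
      rw [D.eval_append_singleton, ih, show G.config (w ++ [a]) = G.step (G.config w) a by
        simp [CopylessSST.config]]
      refine Prod.ext rfl (funext fun r => funext fun s => ?_)
      exact (hrun (G.config w).2 _ s).symm
  ext w
  change D.eval w ∈ D.accept ↔ A.evalFrom A.start (G.eval w) ∈ A.accept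
  rw [hD, CopylessSST.eval, RegisterTransition.act, hrun]
  rfl

theorem mainTheorem5 :
    -- closure under precomposition by regular functions
    (∀ (C : Type*) [Category C] [MonoidalCategory C] [SymmetricCategory C] [MonoidalClosed C]
        (X : Type*) (𝔖 : StreamingSetting C X),
        QuasiAffine C → 𝔖.start = 𝟙_ C →
        ∀ (α Γ : Type*) [Finite α] [Finite Γ] (f : List Γ → X) (g : List α → List Γ),
          𝔖.Computes f → IsRegularFunction g → 𝔖.Computes (f ∘ g)) ∧
    -- preservation of regular languages by inverse image
    (∀ (α Γ : Type*) [Finite α] [Finite Γ] (L : Language Γ) (g : List α → List Γ),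
        L.IsRegular → IsRegularFunction g →
          Language.IsRegular ({w | g w ∈ L} : Language α)) ∧
    -- closure of regular functions under composition
    (∀ (α Γ Δ : Type*) [Finite α] [Finite Γ] [Finite Δ]
        (f : List Γ → List Δ) (g : List α → List Γ),
        IsRegularFunction f → IsRegularFunction g → IsRegularFunction (f ∘ g)) := by
  refine ⟨?_, ?_, ?_⟩
  · intro C _ _ _ _ X 𝔖 hC h𝔖 α Γ _ _ f g hf hg
    exact hf.comp_isRegularFunction hC h𝔖 hg
  · intro α Γ _ _ L g hL hg
    exact hL.preimage hg
  · intro α Γ Δ _ _ _ f g hf hg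
    exact hf.comp hg
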